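/- Let $(X,K,\|\cdot\|)$ be a real ordered Banach space whose cone $K$ is closed and whose order is directed (any two elements have a common upper bound; equivalently $X=K-K$). Let $X'$ be its dual and $K'\subseteq X'$ the set of continuous linear functionals that are nonnegative on $K$. For $\phi\in X'$ put $$p_\phi(x)=\inf\{\langle y,\phi\rangle : y\in X,\ y\ge 0,\ y\ge x\}\in[-\infty,\infty],\qquad x\in X,$$ and for $x\in X$ let $$dp_\phi(x)=\{x'\in K' : \langle y,x'\rangle\le p_\phi(y)\text{ for all }y\in X,\ \langle x,x'\rangle=p_\phi(x)\}.$$ A linear operator $A\colon\mathcal D(A)\subseteq X\to X$ is called $p_\phi$-dissipative if for every $x\in\mathcal D(A)$ there is $y'\in dp_\phi(x)$ with $\langle Ax,y'\rangle\le 0$. A bounded operator $S$ on $X$ is called $p_\phi$-contractive if $p_\phi(Sx)\le p_\phi(x)$ for all $x\in X$. Let $\phi\in X'$ and let $(T(t))_{t\ge 0}$ be a strongly continuous semigroup of bounded linear operators on $X$ whose generator $A$ is $p_\phi$-dissipative, and suppose that $I-\lambda A\colon\mathcal D(A)\to X$ is invertible for some $\lambda>0$. Then $T(t)$ is $p_\phi$-contractive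 for every $t\ge 0$. -/

import Mathlib

open Filter Topology
open scoped NNReal

namespace OrderedSemigroup

section Order

variable {X : Type*} [NormedAddCommGroup X] [NormedSpace ℝ X] [PartialOrder X]

/-- The function `p_φ(x) = inf {⟨y, φ⟩ : y ≥ 0, y ≥ x}` attached to a continuous linear
functional `φ`. The infimum is taken in the extended reals, so that it is the true infimum for
every `φ` and `x`. It is real-valued when `φ` is positive and the order is directed. -/
noncomputable def pPhi (φ : StrongDual ℝ X) (x : X) : EReal :=
  sInf ((fun y : X => ((φ y : ℝ) : EReal)) '' {y : X | 0 ≤ y ∧ x ≤ y})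

/-- The dual cone `K'`: continuous linear functionals that are nonnegative on the cone
`K = {y | 0 ≤ y}`. -/
def dualCone (X : Type*) [NormedAddCommGroup X] [NormedSpace ℝ X] [PartialOrder X] :
    Set (StrongDual ℝ X) :=
  {f | ∀ y : X, 0 ≤ y → 0 ≤ f y}

/-- The subdifferential `dp(x)`: those `x' ∈ K'` with `⟨y, x'⟩ ≤ p(y)` for all `y` and
`⟨x, x'⟩ = p(x)`. -/
def subdiff (p : X → EReal) (x : X) : Set (StrongDual ℝ X) :=
  {f | f ∈ dualCone X ∧ (∀ y : X, ((f y : ℝ) : EReal) ≤ p y) ∧ ((f x : ℝ) : EReal) = p x}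

/-- A linear operator `A : D(A) ⊆ X → X` is `p`-dissipative if for every `x ∈ D(A)` there is
`y' ∈ dp(x)` with `⟨A x, y'⟩ ≤ 0`. -/
def IsDissipative (p : X → EReal) (A : X →ₗ.[ℝ] X) : Prop :=
  ∀ x : A.domain, ∃ f ∈ subdiff p (x : X), f (A x) ≤ 0

end Order

section Semigroup

variable {X : Type*} [NormedAddCommGroup X] [NormedSpace ℝ X]

/-- A bounded operator `T` is `p`-contractive if `p(T x) ≤ p(x)` for all `x`. -/
def IsContractive (p : X → EReal) (T : X →L[ℝ] X) : Prop :=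
  ∀ x : X, p (T x) ≤ p x

/-- Strongly continuous one-parameter semigroups `(T(t))_{t ≥ 0}` of bounded operators. -/
structure IsStronglyContinuousSemigroup (T : ℝ≥0 → X →L[ℝ] X) : Prop where
  map_zero : T 0 = ContinuousLinearMap.id ℝ X
  map_add : ∀ s t : ℝ≥0, T (s + t) = (T s).comp (T t)
  continuous : ∀ x : X, Continuous fun t : ℝ≥0 => T t x

/-- `A` is the generator of `T`: `x ∈ D(A)` and `A x = y` if and only if
`(T(h) x - x) / h → y` as `h ↓ 0`. -/
def IsGenerator (A : X →ₗ.[ℝ] X) (T : ℝ≥0 → X →L[ℝ] X) : Prop :=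
  ∀ x y : X, (x, y) ∈ A.graph ↔
    Tendsto (fun h : ℝ≥0 => (h : ℝ)⁻¹ • (T h x - x)) (𝓝[>] 0) (𝓝 y)

/-- `I - lam A` is invertible as a map `D(A) → X`. (For a closed operator on a Banach space,
in particular for a generator, the inverse is then bounded by the closed graph theorem.) -/
def IsInvertibleIdSub (A : X →ₗ.[ℝ] X) (lam : ℝ) : Prop :=
  Function.Bijective fun x : A.domain => (x : X) - lam • A x

end Semigroup

end OrderedSemigroup

namespace OrderedSemigroup

/-! ### Domination by positive elements with norm control. -/

section Cone

variable {X : Type*} [NormedAddCommGroup X] [NormedSpace ℝ X]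
  [PartialOrder X]

/-! Write p for `pPhi φ`. A subgradient at 0 keeps p above -∞; norm-controlled domination
(`exists_dominating_norm_le`) bounds it by a multiple of the norm. Being subadditive, p is then
Lipschitz. A subgradient y' at x with ⟨Ax, y'⟩ ≤ 0 gives p(x) ≤ ⟨x - hAx, y'⟩ ≤ p(x - hAx) for h ≥
0. For x in the domain, T(s+h)x - hAT(s+h)x = T(s)x + o(h), so p(T(s+h)x) ≤ p(T(s)x) + o(h): the
orbit has upper right slope at most 0, and p decreases along it
(`IsGenerator.apply_le_of_mem_graph`). Density of the domain and continuity of p give all x. -/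

theorem pPhi_le {φ : StrongDual ℝ X} {x y : X} (hy : 0 ≤ y) (hxy : x ≤ y) :
    pPhi φ x ≤ (φ y : ℝ) :=
  sInf_le ⟨y, ⟨hy, hxy⟩, rfl⟩

variable [IsOrderedAddMonoid X]

theorem pPhi_add_le {φ : StrongDual ℝ X} {q : X → ℝ} (hq : ∀ x, (q x : EReal) = pPhi φ x)
    (x y : X) : q (x + y) ≤ q x + q y := by
  have key : ∀ x, ∀ ε > 0, ∃ z, 0 ≤ z ∧ x ≤ z ∧ φ z < q x + ε := fun x ε hε => by
    have : pPhi φ x < ((q x + ε : ℝ) : EReal) := by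
      rw [← hq, EReal.coe_lt_coe_iff]
      linarith
    obtain ⟨_, ⟨z, ⟨hz, hxz⟩, rfl⟩, hlt⟩ := sInf_lt_iff.1 this
    exact ⟨z, hz, hxz, EReal.coe_lt_coe_iff.1 hlt⟩
  refine le_of_forall_pos_le_add fun ε hε => ?_
  obtain ⟨u, hu, hxu, h₁⟩ := key x (ε / 2) (by positivity)
  obtain ⟨v, hv, hyv, h₂⟩ := key y (ε / 2) (by positivity)
  have h := pPhi_le (φ := φ) (add_nonneg hu hv) (add_le_add hxu hyv)
  rw [← hq, EReal.coe_le_coe_iff, map_add] at h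
  linarith

variable [PosSMulMono ℝ X]

/-- Baire category step: up to an arbitrarily small error relative to `‖x‖`, every `x` is
dominated by a positive element whose norm is controlled by `‖x‖`. -/
theorem exists_approx_dominating [CompleteSpace X]
    (hdirected : ∀ x y : X, ∃ z : X, x ≤ z ∧ y ≤ z) :
    ∃ M : ℝ, 0 ≤ M ∧ ∀ x : X, ∃ w y : X, ‖w‖ ≤ ‖x‖ / 2 ∧ 0 ≤ y ∧ x - w ≤ y ∧ ‖y‖ ≤ M * ‖x‖ := by
  let V : ℕ → Set X := fun n => {x | ∃ y : X, 0 ≤ y ∧ x ≤ y ∧ ‖y‖ ≤ n}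
  have hV : ∀ x, ∃ n, x ∈ V n := fun x => by
    obtain ⟨z, hxz, hz⟩ := hdirected x 0
    obtain ⟨n, hn⟩ := exists_nat_ge ‖z‖
    exact ⟨n, z, hz, hxz, hn⟩
  obtain ⟨n, a, ha⟩ := nonempty_interior_of_iUnion_of_closed
    (fun n => isClosed_closure (s := V n))
    (Set.eq_univ_of_forall fun x => by
      obtain ⟨n, hn⟩ := hV x
      exact Set.mem_iUnion.2 ⟨n, subset_closure hn⟩)
  obtain ⟨r, hr, hball⟩ := Metric.isOpen_iff.1 isOpen_interior a ha
  -- A dominator of `-a` recentres the ball at the origin.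
  obtain ⟨m, y₁, hy₁, hay₁, hny₁⟩ := hV (-a)
  refine ⟨2 * (n + m) / r, by positivity, fun x => ?_⟩
  rcases eq_or_ne x 0 with rfl | hx
  · exact ⟨0, 0, by simp⟩
  have hx' : 0 < ‖x‖ := norm_pos_iff.2 hx
  set c : ℝ := r / (2 * ‖x‖) with hc
  have hcpos : 0 < c := by positivity
  have hmem : a + c • x ∈ closure (V n) := by
    refine interior_subset (hball ?_)
    have : c * ‖x‖ = r / 2 := by rw [hc]; field_simp
    simp only [Metric.mem_ball, dist_eq_norm, add_sub_cancel_left, norm_smul, Real.norm_eq_abs,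
      abs_of_pos hcpos, this]
    linarith
  obtain ⟨b, ⟨y, hy, hby, hny⟩, hb⟩ :=
    Metric.mem_closure_iff.1 hmem (c * (‖x‖ / 2)) (by positivity)
  refine ⟨c⁻¹ • (a + c • x - b), c⁻¹ • (y + y₁), ?_, ?_, ?_, ?_⟩
  · rw [norm_smul, Real.norm_eq_abs, abs_of_pos (inv_pos.2 hcpos), inv_mul_le_iff₀ hcpos,
      ← dist_eq_norm]
    exact hb.le
  · exact smul_nonneg (inv_pos.2 hcpos).le (add_nonneg hy hy₁)
  · have : x - c⁻¹ • (a + c • x - b) = c⁻¹ • (b + -a) := by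
      rw [smul_sub, smul_add, smul_smul, inv_mul_cancel₀ hcpos.ne', one_smul, smul_add, smul_neg]
      abel
    rw [this]
    exact smul_le_smul_of_nonneg_left (add_le_add hby hay₁) (inv_pos.2 hcpos).le
  · rw [norm_smul, Real.norm_eq_abs, abs_of_pos (inv_pos.2 hcpos)]
    calc c⁻¹ * ‖y + y₁‖ ≤ c⁻¹ * (n + m) := by
          gcongr
          exact (norm_add_le _ _).trans (add_le_add hny hny₁)
      _ = 2 * (n + m) / r * ‖x‖ := by rw [hc]; field_simp

/-- In a Banach space directed by a closed cone, every `x` is dominated by a positive element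
of norm at most a constant times `‖x‖`. -/
theorem exists_dominating_norm_le [CompleteSpace X] (hclosed : IsClosed {x : X | 0 ≤ x})
    (hdirected : ∀ x y : X, ∃ z : X, x ≤ z ∧ y ≤ z) :
    ∃ M : ℝ, 0 ≤ M ∧ ∀ x : X, ∃ y : X, 0 ≤ y ∧ x ≤ y ∧ ‖y‖ ≤ M * ‖x‖ := by
  obtain ⟨M, hM, h⟩ := exists_approx_dominating hdirected
  choose w y hw hy hwy hny using h
  refine ⟨M * 2, by positivity, fun x => ?_⟩
  let u : ℕ → X := fun n => w^[n] x
  have hu : ∀ n, u (n + 1) = w (u n) := fun n => Function.iterate_succ_apply' w n x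
  have hun : ∀ n, ‖u n‖ ≤ ‖x‖ * (1 / 2) ^ n := by
    intro n
    induction n with
    | zero => simp [u]
    | succ k ih =>
      rw [hu, pow_succ]
      linarith [hw (u k)]
  have hbound : ∀ n, ‖y (u n)‖ ≤ M * ‖x‖ * (1 / 2) ^ n := fun n => by
    rw [mul_assoc]
    exact (hny _).trans (mul_le_mul_of_nonneg_left (hun n) hM)
  have hgeom : HasSum (fun n : ℕ => M * ‖x‖ * (1 / 2 : ℝ) ^ n) (M * ‖x‖ * 2) :=
    hasSum_geometric_two.mul_left _
  have hsum : Summable fun n => y (u n) := .of_norm_bounded hgeom.summable hbound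
  have hpartial : ∀ n, x - u n ≤ ∑ i ∈ Finset.range n, y (u i) := by
    intro n
    induction n with
    | zero => simp [u]
    | succ k ih =>
      rw [Finset.sum_range_succ, hu]
      simpa using add_le_add ih (hwy (u k))
  have htend := hsum.hasSum.tendsto_sum_nat
  have hu0 : Tendsto u atTop (𝓝 0) := by
    refine squeeze_zero_norm hun ?_
    simpa using (tendsto_pow_atTop_nhds_zero_of_lt_one
      (by norm_num : (0 : ℝ) ≤ 1 / 2) (by norm_num)).const_mul ‖x‖
  refine ⟨∑' n, y (u n), ?_, ?_, ?_⟩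
  · exact hclosed.mem_of_tendsto htend (.of_forall fun n => Finset.sum_nonneg fun i _ => hy _)
  · have := hclosed.mem_of_tendsto (htend.sub (tendsto_const_nhds.sub hu0))
      (.of_forall fun n => sub_nonneg.2 (hpartial n))
    simpa using this
  · exact (tsum_of_norm_bounded hgeom hbound).trans_eq (by ring)

end Cone

/-! ### Generators and decrease along orbits. -/

section Semigroup

variable {X : Type*} [NormedAddCommGroup X] [NormedSpace ℝ X] {T : ℝ≥0 → X →L[ℝ] X}

theorem IsGenerator.map_mem_graph (hT : IsStronglyContinuousSemigroup T) {A : X →ₗ.[ℝ] X}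
    (hA : IsGenerator A T) {x y : X} (hxy : (x, y) ∈ A.graph) (s : ℝ≥0) :
    (T s x, T s y) ∈ A.graph := by
  rw [hA] at hxy ⊢
  refine (((T s).continuous.tendsto y).comp hxy).congr fun h => ?_
  have : T h (T s x) = T s (T h x) := by
    rw [← ContinuousLinearMap.comp_apply, ← hT.map_add, add_comm, hT.map_add,
      ContinuousLinearMap.comp_apply]
  simp [this]

/-- The averages of an orbit over [0, h] lie in the domain and tend to its starting point. -/
theorem IsGenerator.dense_domain [CompleteSpace X] (hT : IsStronglyContinuousSemigroup T)
    {A : X →ₗ.[ℝ] X} (hA : IsGenerator A T) : Dense (A.domain : Set X) := by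
  intro x
  let F : ℝ → X := fun s => T s.toNNReal x
  -- `F` is constant on the negative axis, so `G` has a two-sided derivative even at 0.
  have hF : Continuous F := (hT.continuous x).comp continuous_real_toNNReal
  let G : ℝ → X := fun u => ∫ s in (0 : ℝ)..u, F s
  have hG : ∀ u, HasDerivAt G (F u) u := fun u =>
    intervalIntegral.integral_hasDerivAt_right (hF.intervalIntegrable _ _)
      hF.stronglyMeasurable.stronglyMeasurableAtFilter hF.continuousAt
  have hG0 : G 0 = 0 := intervalIntegral.integral_same
  have hTG : ∀ (r : ℝ≥0) (u : ℝ), 0 ≤ u → T r (G u) = G (u + r) - G r := fun r u hu => by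
    calc T r (G u) = ∫ s in (0 : ℝ)..u, T r (F s) :=
          ((T r).intervalIntegral_comp_comm (hF.intervalIntegrable _ _)).symm
      _ = ∫ s in (0 : ℝ)..u, F (s + r) := by
          refine intervalIntegral.integral_congr fun s hs => ?_
          rw [Set.uIcc_of_le hu] at hs
          simp only [F]
          rw [Real.toNNReal_add hs.1 r.coe_nonneg, Real.toNNReal_coe, add_comm, hT.map_add,
            ContinuousLinearMap.comp_apply]
      _ = ∫ s in (r : ℝ)..(u + r), F s := by
          rw [intervalIntegral.integral_comp_add_right, zero_add]
      _ = G (u + r) - G r :=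
          (intervalIntegral.integral_interval_sub_left (hF.intervalIntegrable _ _)
            (hF.intervalIntegrable _ _)).symm
  have hcoe : Tendsto ((↑) : ℝ≥0 → ℝ) (𝓝[>] 0) (𝓝[≠] 0) :=
    tendsto_nhdsWithin_iff.2 ⟨(NNReal.continuous_coe.tendsto 0).mono_left nhdsWithin_le_nhds, by
      filter_upwards [self_mem_nhdsWithin] with h hh
      exact NNReal.coe_ne_zero.2 (ne_of_gt hh)⟩
  have hmem : ∀ u : ℝ, 0 ≤ u → G u ∈ A.domain := fun u hu => by
    have hd : HasDerivAt (fun r => G (u + r) - G r) (F u - F 0) 0 := by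
      have h₁ : HasDerivAt (fun r => G (u + r)) (F u) 0 :=
        HasDerivAt.comp_const_add u 0 (by simpa using hG u)
      exact h₁.sub (hG 0)
    refine LinearPMap.mem_domain_of_mem_graph ((hA (G u) (F u - F 0)).2 ?_)
    refine ((hasDerivAt_iff_tendsto_slope.1 hd).comp hcoe).congr fun h => ?_
    simp [slope_def_module, hTG h u hu, hG0]
  have hlim : Tendsto (fun h : ℝ≥0 => (h : ℝ)⁻¹ • G h) (𝓝[>] 0) (𝓝 x) := by
    have hx : F 0 = x := by simp [F, hT.map_zero]
    rw [← hx]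
    refine ((hasDerivAt_iff_tendsto_slope.1 (hG 0)).comp hcoe).congr fun h => ?_
    simp [slope_def_module, hG0]
  exact mem_closure_of_tendsto hlim
    (.of_forall fun h => A.domain.smul_mem _ (hmem h h.2))

/-- A Lipschitz-bounded subadditive function that decreases under the resolvents of the generator
(`q z ≤ q (z - h A z)`) decreases along the orbits starting in the domain. -/
theorem IsGenerator.apply_le_of_mem_graph (hT : IsStronglyContinuousSemigroup T)
    {A : X →ₗ.[ℝ] X} (hA : IsGenerator A T) {q : X → ℝ} {C : ℝ}
    (hadd : ∀ x y, q (x + y) ≤ q x + q y) (hC : ∀ x, q x ≤ C * ‖x‖) (hq : Continuous q)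
    (hdiss : ∀ x y, (x, y) ∈ A.graph → ∀ h : ℝ, 0 ≤ h → q x ≤ q (x - h • y))
    {x y : X} (hxy : (x, y) ∈ A.graph) (t : ℝ≥0) : q (T t x) ≤ q x := by
  let f : ℝ → ℝ := fun s => q (T s.toNNReal x)
  have hf : Continuous f := hq.comp ((hT.continuous x).comp continuous_real_toNNReal)
  have hf0 : f 0 = q x := by simp [f, hT.map_zero]
  have main := image_le_of_liminf_slope_right_le_deriv_boundary (f := f) (a := 0) (b := t)
    hf.continuousOn (B := fun _ => q x) (B' := fun _ => 0) hf0.le continuousOn_const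
    (fun s _ => hasDerivWithinAt_const _ _ _) ?_ (Set.right_mem_Icc.2 t.2)
  · simpa [f] using main
  intro s hs r hr
  lift s to ℝ≥0 using hs.1
  have hlim : Tendsto (fun h : ℝ≥0 => C * ‖T s (T h y - (h : ℝ)⁻¹ • (T h x - x))‖)
      (𝓝[>] 0) (𝓝 0) := by
    have h₁ : Tendsto (fun h : ℝ≥0 => T h y) (𝓝[>] 0) (𝓝 y) := by
      have := ((hT.continuous y).tendsto 0).mono_left (nhdsWithin_le_nhds (s := Set.Ioi 0))
      simpa [hT.map_zero] using this
    have h₂ := (((T s).continuous.tendsto _).comp (h₁.sub ((hA x y).1 hxy))).norm.const_mul C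
    simpa using h₂
  have hshift : Tendsto (fun z : ℝ => (z - s).toNNReal) (𝓝[>] (s : ℝ)) (𝓝[>] 0) := by
    refine tendsto_nhdsWithin_iff.2 ⟨?_, ?_⟩
    · have : Continuous fun z : ℝ => (z - s).toNNReal := by fun_prop
      simpa using (this.tendsto (s : ℝ)).mono_left nhdsWithin_le_nhds
    · filter_upwards [self_mem_nhdsWithin] with z hz
      exact Real.toNNReal_pos.2 (sub_pos.2 hz)
  refine Eventually.frequently ?_
  filter_upwards [(hlim.comp hshift).eventually (gt_mem_nhds hr), self_mem_nhdsWithin] with z hz hsz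
  obtain ⟨h, rfl⟩ : ∃ h : ℝ≥0, z = s + h :=
    ⟨(z - s).toNNReal, by rw [Real.coe_toNNReal _ (sub_nonneg.2 (le_of_lt hsz))]; ring⟩
  have hh : (0 : ℝ) < h := by simpa using hsz
  simp only [Function.comp_apply, add_sub_cancel_left, Real.toNNReal_coe] at hz
  refine lt_of_le_of_lt ?_ hz
  have hfs : f s = q (T s x) := by simp [f]
  have hfsh : f (s + h) = q (T (s + h) x) := by
    simp only [f]
    rw [← NNReal.coe_add, Real.toNNReal_coe]
  rw [slope_def_field, hfs, hfsh, add_sub_cancel_left, div_le_iff₀ hh]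
  -- Dissipativity is used at the right endpoint, as in an implicit Euler step.
  have h₁ := hdiss _ _ (hA.map_mem_graph hT hxy (s + h)) h h.2
  have h₂ : T (s + h) x - (h : ℝ) • T (s + h) y
      = T s x + -((h : ℝ) • T s (T h y - (h : ℝ)⁻¹ • (T h x - x))) := by
    simp only [hT.map_add, ContinuousLinearMap.comp_apply, map_sub, map_smul, smul_sub, smul_smul,
      mul_inv_cancel₀ hh.ne', one_smul]
    abel
  rw [h₂] at h₁
  have h₃ := hC (-((h : ℝ) • T s (T h y - (h : ℝ)⁻¹ • (T h x - x))))
  rw [norm_neg, norm_smul, Real.norm_eq_abs, abs_of_pos hh] at h₃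
  linarith [hadd (T s x) (-((h : ℝ) • T s (T h y - (h : ℝ)⁻¹ • (T h x - x))))]

end Semigroup

end OrderedSemigroup

open OrderedSemigroup in
theorem mainTheorem2 {X : Type*} [NormedAddCommGroup X] [NormedSpace ℝ X] [CompleteSpace X]
    [PartialOrder X] [IsOrderedAddMonoid X] [PosSMulMono ℝ X]
    (hclosed : IsClosed {x : X | 0 ≤ x})
    (hdirected : ∀ x y : X, ∃ z : X, x ≤ z ∧ y ≤ z)
    (φ : StrongDual ℝ X)
    (T : ℝ≥0 → X →L[ℝ] X) (hT : OrderedSemigroup.IsStronglyContinuousSemigroup T)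
    (A : X →ₗ.[ℝ] X) (hA : OrderedSemigroup.IsGenerator A T)
    (hdiss : OrderedSemigroup.IsDissipative (OrderedSemigroup.pPhi φ) A)
    (hinv : ∃ lam : ℝ, 0 < lam ∧ OrderedSemigroup.IsInvertibleIdSub A lam) :
    ∀ t : ℝ≥0, OrderedSemigroup.IsContractive (OrderedSemigroup.pPhi φ) (T t) := by
  obtain ⟨M, hM, hdom⟩ := exists_dominating_norm_le hclosed hdirected
  have hreal : ∀ x, ∃ r : ℝ, (r : EReal) = pPhi φ x := fun x => by
    obtain ⟨f, ⟨-, hf, -⟩, -⟩ := hdiss 0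
    obtain ⟨y, hy, hxy, -⟩ := hdom x
    exact ⟨_, EReal.coe_toReal (ne_top_of_le_ne_top (EReal.coe_ne_top _) (pPhi_le hy hxy))
      (ne_bot_of_le_ne_bot (EReal.coe_ne_bot _) (hf x))⟩
  choose q hq using hreal
  have hadd := pPhi_add_le hq
  have hC : ∀ x, q x ≤ ‖φ‖ * M * ‖x‖ := fun x => by
    obtain ⟨y, hy, hxy, hny⟩ := hdom x
    have h := pPhi_le (φ := φ) hy hxy
    rw [← hq, EReal.coe_le_coe_iff] at h
    calc q x ≤ ‖φ‖ * ‖y‖ := h.trans ((le_abs_self _).trans (φ.le_opNorm y))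
      _ ≤ ‖φ‖ * (M * ‖x‖) := by gcongr
      _ = _ := by ring
  have hcont : Continuous q := by
    refine (LipschitzWith.of_le_add_mul (⟨‖φ‖ * M, by positivity⟩ : ℝ≥0) fun x y => ?_).continuous
    have h := hadd y (x - y)
    rw [add_sub_cancel] at h
    rw [dist_eq_norm]
    exact h.trans (add_le_add_right (hC _) _)
  have hdq : ∀ x y, (x, y) ∈ A.graph → ∀ h : ℝ, 0 ≤ h → q x ≤ q (x - h • y) := by
    intro x y hxy h hh
    obtain ⟨z, rfl, rfl⟩ := (LinearPMap.mem_graph_iff A).1 hxy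
    obtain ⟨f, ⟨-, hle, heq⟩, hfz⟩ := hdiss z
    have h₁ := hle (z - h • A z)
    rw [← hq, EReal.coe_le_coe_iff, map_sub, map_smul, smul_eq_mul] at h₁
    rw [← hq, EReal.coe_eq_coe_iff] at heq
    linarith [mul_nonpos_of_nonneg_of_nonpos hh hfz]
  intro t x
  rw [← hq, ← hq, EReal.coe_le_coe_iff]
  refine (hA.dense_domain hT).induction (P := fun x => q (T t x) ≤ q x) (fun z hz => ?_)
    (isClosed_le (hcont.comp (T t).continuous) hcont) x
  exact hA.apply_le_of_mem_graph hT hadd hC hcont hdq (A.mem_graph ⟨z, hz⟩) t
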